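/- For $x,a\in\mathbb R$ write $x^{\langle a\rangle}=|x|^a\,\mathrm{sign}(x)$. Let $1<\alpha\le 2$, $m,T\in\mathbb N$, $T\ge 1$, and let $\Gamma$ be a finite symmetric measure on the unit sphere $S_m$ of $\mathbb R^m$. Let $\{\mathbf Z(t)\}_{t\in\mathbb Z}$ be a sequence of independent symmetric $\alpha$-stable random vectors in $\mathbb R^m$, each with characteristic function $\boldsymbol\theta\mapsto\exp\{-\int_{S_m}|\langle\boldsymbol\theta,\mathbf s\rangle|^\alpha\,\Gamma(d\mathbf s)\}$. Let $\Theta(t)=(\theta_{rl}(t))_{r,l=1}^m$, $t\in\mathbb Z$, be real diagonal matrices ($\theta_{rl}(t)=0$ for $r\ne l$) with $\Theta(t+T)=\Theta(t)$ for all $t$, and put $$P_r=\theta_{rr}(1)\theta_{rr}(2)\cdots\theta_{rr}(T),\qquad g(t,u)=\Theta(t)\Theta(t-1)\cdots\Theta(u)\ (u\le t),\qquad g(t,t+1)=I .$$ Assume $|P_r|<1$ for all $r\in\{1,\dots,m\}$, and let $$\mathbf X(t)=\sum_{j=0}^{\infty}g(t,t-j+1)\,\mathbf Z(t-j)\quad\text{almost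 surely},\qquad t\in\mathbb Z .$$ Then for every $t\in\mathbb Z$ this series converges absolutely almost surely, and almost surely $\mathbf X(t)=\Theta(t)\mathbf X(t-1)+\mathbf Z(t)$. For a jointly symmetric $\alpha$-stable pair $(X,Y)$ with spectral measure $\Gamma_{X,Y}$ (a finite symmetric measure on the unit circle $S_2$ with $E\,e^{i(\theta_1X+\theta_2Y)}=\exp\{-\int_{S_2}|\theta_1s_1+\theta_2s_2|^\alpha\,\Gamma_{X,Y}(d\mathbf s)\}$), the covariation of $X$ on $Y$ is $\mathrm{CV}(X,Y)=\int_{S_2}s_1s_2^{\langle\alpha-1\rangle}\,\Gamma_{X,Y}(d\mathbf s)$. Then for all $r,l\in\{1,\dots,m\}$ with $r\ne l$ and all $s,t\in\mathbb Z$, the pair $(X_r(s),X_l(t))$ is jointly symmetric $\alpha$-stable, and: (a) if $s\ge t$, $$\mathrm{CV}(X_r(s),X_l(t))=\frac{g_{rr}(s,t+1)\int_{S_m}s_l^{\langle\alpha-1\rangle}s_r\,\Gamma(d\mathbf s)}{1-P_l^{\langle\alpha-1\rangle}P_r}\sum_{k=0}^{T-1}g_{ll}(t,t-k+1)^{\langle\alpha-1\rangle}g_{rr}(t,t-k+1);$$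 (b) if $s\le t$, $$\mathrm{CV}(X_r(s),X_l(t))=\frac{g_{ll}(t,s+1)^{\langle\alpha-1\rangle}\int_{S_m}s_l^{\langle\alpha-1\rangle}s_r\,\Gamma(d\mathbf s)}{1-P_l^{\langle\alpha-1\rangle}P_r}\sum_{k=0}^{T-1}g_{ll}(s,s-k+1)^{\langle\alpha-1\rangle}g_{rr}(s,s-k+1).$$ Moreover, the cross-covariation is periodic in $s$ with period $T$ for every fixed difference $s-t$: $\mathrm{CV}(X_r(s+T),X_l(t+T))=\mathrm{CV}(X_r(s),X_l(t))$. -/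

import Mathlib

open MeasureTheory ProbabilityTheory

/-- The signed power `x^{⟨a⟩} = |x|^a sign x`. -/
noncomputable def signedPow (x a : ℝ) : ℝ := |x| ^ a * Real.sign x

/-- `Γ` is a spectral measure of the random vector `V` in `ℝ^d`, with stability index `α`: a finite
symmetric measure on the Euclidean unit sphere such that the characteristic function of `V` is
`θ ↦ exp (-∫ |⟨θ, s⟩|^α Γ(ds))`. That is, `V` is a symmetric `α`-stable vector, `V ∼ S_α(Γ)`. -/
structure IsSpectralMeasure {Ω : Type*} [MeasurableSpace Ω] {d : ℕ} (α : ℝ) (μ : Measure Ω)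
    (V : Ω → EuclideanSpace ℝ (Fin d))
    (Γ : Measure (Metric.sphere (0 : EuclideanSpace ℝ (Fin d)) 1)) : Prop where
  aemeasurable : AEMeasurable V μ
  finite : IsFiniteMeasure Γ
  symmetric : Γ.map (fun s => -s) = Γ
  charFun_eq : ∀ θ : EuclideanSpace ℝ (Fin d),
    charFun (μ.map V) θ
      = Complex.exp (-((∫ s, |inner ℝ θ (s : EuclideanSpace ℝ (Fin d))| ^ α ∂Γ : ℝ) : ℂ))

/-- The random vector `(X, Y)` in the Euclidean plane. -/
noncomputable def pairVec {Ω : Type*} (X Y : Ω → ℝ) (ω : Ω) : EuclideanSpace ℝ (Fin 2) :=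
  !₂[X ω, Y ω]

/-- `X` and `Y` are jointly symmetric `α`-stable. -/
def IsJointlySaS {Ω : Type*} [MeasurableSpace Ω] (α : ℝ) (μ : Measure Ω) (X Y : Ω → ℝ) : Prop :=
  ∃ Γ, IsSpectralMeasure α μ (pairVec X Y) Γ

open Classical in
/-- The covariation `CV(X, Y) = ∫ s₁ s₂^{⟨α-1⟩} Γ(ds)` of `X` on `Y`, where `Γ` is the spectral
measure of `(X, Y)`; the value is `0` by convention if `(X, Y)` is not symmetric `α`-stable.
By `IsSpectralMeasure.covariation_eq` below it does not depend on the chosen spectral measure. -/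
noncomputable def covariation {Ω : Type*} [MeasurableSpace Ω] (α : ℝ) (μ : Measure Ω)
    (X Y : Ω → ℝ) : ℝ :=
  if h : IsJointlySaS α μ X Y then
    ∫ s, (s : EuclideanSpace ℝ (Fin 2)) 0 * signedPow ((s : EuclideanSpace ℝ (Fin 2)) 1) (α - 1)
      ∂(Classical.choose h)
  else 0

lemma abs_coord_le_one {d : ℕ} (s : Metric.sphere (0 : EuclideanSpace ℝ (Fin d)) 1) (i : Fin d) :
    |(s : EuclideanSpace ℝ (Fin d)) i| ≤ 1 := by
  have h := PiLp.norm_apply_le (s : EuclideanSpace ℝ (Fin d)) i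
  have hs : ‖(s : EuclideanSpace ℝ (Fin d))‖ = 1 := by simp
  rw [hs] at h
  exact h

/-- The `α`-th power of the scale of `h X + Y` has derivative `α ∫ s₁ s₂^{⟨α-1⟩} Γ(ds)` at `0`. -/
lemma hasDerivAt_scale {α : ℝ} (hα : 1 < α)
    (Γ : Measure (Metric.sphere (0 : EuclideanSpace ℝ (Fin 2)) 1)) [IsFiniteMeasure Γ] :
    HasDerivAt
      (fun h : ℝ => ∫ s, |inner ℝ !₂[h, 1] (s : EuclideanSpace ℝ (Fin 2))| ^ α ∂Γ)
      (α * ∫ s, (s : EuclideanSpace ℝ (Fin 2)) 0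
        * signedPow ((s : EuclideanSpace ℝ (Fin 2)) 1) (α - 1) ∂Γ) 0 := by
  have hinner : ∀ (h : ℝ) (s : Metric.sphere (0 : EuclideanSpace ℝ (Fin 2)) 1),
      inner ℝ !₂[h, 1] (s : EuclideanSpace ℝ (Fin 2)) = h * s.1 0 + s.1 1 := by
    intro h s
    simp [PiLp.inner_apply, Fin.sum_univ_two, mul_comm]
  simp_rw [hinner]
  have hc : ∀ i : Fin 2, Continuous
      (fun s : Metric.sphere (0 : EuclideanSpace ℝ (Fin 2)) 1 => s.1 i) := fun i => by fun_prop
  have hlin : ∀ h : ℝ, Continuous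
      (fun s : Metric.sphere (0 : EuclideanSpace ℝ (Fin 2)) 1 => h * s.1 0 + s.1 1) :=
    fun h => ((hc 0).const_smul h).add (hc 1)
  have hsp : ∀ x : ℝ, α * |x| ^ (α - 2) * x = α * signedPow x (α - 1) := by
    intro x
    unfold signedPow
    rcases eq_or_ne x 0 with rfl | hx
    · simp
    · have hx' : 0 < |x| := abs_pos.mpr hx
      have h1 : |x| ^ (α - 1) = |x| ^ (α - 2) * |x| := by
        rw [← Real.rpow_add_one hx'.ne']
        congr 1
        ring
      rw [h1, mul_assoc, mul_assoc]
      congr 2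
      rcases lt_or_gt_of_ne hx with h | h
      · rw [Real.sign_of_neg h, abs_of_neg h]; ring
      · rw [Real.sign_of_pos h, abs_of_pos h]; ring
  have hspb : ∀ x : ℝ, |x| ≤ 2 → |signedPow x (α - 1)| ≤ 2 ^ (α - 1) := by
    intro x hx
    unfold signedPow
    have h1 : |x| ^ (α - 1) ≤ 2 ^ (α - 1) :=
      Real.rpow_le_rpow (abs_nonneg _) hx (by linarith)
    have h0 : 0 ≤ |x| ^ (α - 1) := Real.rpow_nonneg (abs_nonneg _) _
    have h2 : |Real.sign x| ≤ 1 := by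
      rcases Real.sign_apply_eq x with h | h | h <;> simp [h]
    rw [abs_mul, abs_of_nonneg h0]
    calc _ ≤ |x| ^ (α - 1) * 1 := by gcongr
      _ ≤ _ := by linarith
  have hspm : Measurable (fun x : ℝ => signedPow x (α - 1)) := by
    have : (fun x : ℝ => signedPow x (α - 1)) = fun x => |x| ^ (α - 2) * x := by
      funext x
      have := hsp x
      have hα0 : α ≠ 0 := by linarith
      rw [mul_assoc] at this
      exact (mul_left_cancel₀ hα0 this).symm
    rw [this]
    fun_prop
  have key := hasDerivAt_integral_of_dominated_loc_of_deriv_le (μ := Γ) (𝕜 := ℝ)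
    (F := fun (h : ℝ) s => |h * s.1 0 + s.1 1| ^ α)
    (F' := fun (h : ℝ) s => α * (s.1 0 * signedPow (h * s.1 0 + s.1 1) (α - 1)))
    (x₀ := 0) (s := Metric.ball 0 1) (bound := fun _ => α * 2 ^ (α - 1))
    (Metric.ball_mem_nhds _ one_pos)
    (Filter.Eventually.of_forall fun h =>
      (((hlin h).abs.rpow_const fun _ => Or.inr (by linarith)).aestronglyMeasurable))
    (by
      refine Integrable.of_bound (C := 1)
        (((hlin 0).abs.rpow_const fun _ => Or.inr (by linarith)).aestronglyMeasurable) ?_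
      refine Filter.Eventually.of_forall fun s => ?_
      have h0 : 0 ≤ |(0 : ℝ) * s.1 0 + s.1 1| ^ α := Real.rpow_nonneg (abs_nonneg _) _
      rw [Real.norm_eq_abs, abs_of_nonneg h0]
      refine Real.rpow_le_one (abs_nonneg _) ?_ (by linarith)
      simpa using abs_coord_le_one s 1)
    (((hc 0).measurable.mul (hspm.comp (hlin 0).measurable)).const_mul α).aestronglyMeasurable
    (by
      refine Filter.Eventually.of_forall fun s h hh => ?_
      have hh' : |h| ≤ 1 := by
        have := Metric.mem_ball.mp hh
        rw [Real.dist_eq, sub_zero] at this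
        exact this.le
      have hs0 := abs_coord_le_one s 0
      have hs1 := abs_coord_le_one s 1
      have hle : |h * s.1 0 + s.1 1| ≤ 2 := by
        calc _ ≤ |h * s.1 0| + |s.1 1| := abs_add_le _ _
          _ ≤ 1 * 1 + 1 := by rw [abs_mul]; gcongr
          _ = 2 := by norm_num
      rw [Real.norm_eq_abs, abs_mul, abs_mul, abs_of_pos (by linarith : 0 < α)]
      have := hspb _ hle
      have h2 : (0 : ℝ) ≤ 2 ^ (α - 1) := by positivity
      gcongr
      calc _ ≤ 1 * (2 : ℝ) ^ (α - 1) := by gcongr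
        _ = _ := one_mul _)
    (integrable_const _)
    (by
      refine Filter.Eventually.of_forall fun s h _ => ?_
      have hl : HasDerivAt (fun h : ℝ => h * s.1 0 + s.1 1) (s.1 0) h := by
        simpa using ((hasDerivAt_id h).mul_const (s.1 0)).add_const (s.1 1)
      have := (hasDerivAt_abs_rpow (h * s.1 0 + s.1 1) hα).comp h hl
      rw [hsp] at this
      exact this.congr_deriv (by ring))
  have h2 := key.2
  simp only [zero_mul, zero_add, integral_const_mul] at h2
  exact h2

/-- The covariation may be computed with any spectral measure of the pair. -/
theorem IsSpectralMeasure.covariation_eq {Ω : Type*} [MeasurableSpace Ω] {α : ℝ} (hα : 1 < α)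
    {μ : Measure Ω} {X Y : Ω → ℝ} {Γ : Measure (Metric.sphere (0 : EuclideanSpace ℝ (Fin 2)) 1)}
    (hΓ : IsSpectralMeasure α μ (pairVec X Y) Γ) :
    covariation α μ X Y
      = ∫ s, (s : EuclideanSpace ℝ (Fin 2)) 0
          * signedPow ((s : EuclideanSpace ℝ (Fin 2)) 1) (α - 1) ∂Γ := by
  have hJ : IsJointlySaS α μ X Y := ⟨Γ, hΓ⟩
  rw [covariation, dif_pos hJ]
  have hch := Classical.choose_spec hJ
  set Γ' := Classical.choose hJ
  have := hΓ.finite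
  have := hch.finite
  have hfun : (fun h : ℝ => ∫ s, |inner ℝ !₂[h, 1] (s : EuclideanSpace ℝ (Fin 2))| ^ α ∂Γ')
      = fun h : ℝ => ∫ s, |inner ℝ !₂[h, 1] (s : EuclideanSpace ℝ (Fin 2))| ^ α ∂Γ := by
    funext h
    have e := (hch.charFun_eq !₂[h, 1]).symm.trans (hΓ.charFun_eq !₂[h, 1])
    rw [← Complex.ofReal_neg, ← Complex.ofReal_neg, ← Complex.ofReal_exp,
      ← Complex.ofReal_exp] at e
    exact neg_injective (Real.exp_injective (Complex.ofReal_injective e))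
  have h1 := hasDerivAt_scale hα Γ'
  rw [hfun] at h1
  have hα0 : α ≠ 0 := by linarith
  exact mul_left_cancel₀ hα0 (h1.unique (hasDerivAt_scale hα Γ))

/-- The product `Θ(t) Θ(t-1) ⋯ Θ(t-j+1)` of `j` coefficient matrices; the identity for `j = 0`. -/
def coefProd {m : ℕ} (Θ : ℤ → Matrix (Fin m) (Fin m) ℝ) (t : ℤ) : ℕ → Matrix (Fin m) (Fin m) ℝ
  | 0 => 1
  | j + 1 => coefProd Θ t j * Θ (t - j)

/-- The matrix `g(t, u) = Θ(t) Θ(t-1) ⋯ Θ(u)` for `u ≤ t`, with `g(t, t+1) = I`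
(only used for `u ≤ t + 1`). -/
def gMat {m : ℕ} (Θ : ℤ → Matrix (Fin m) (Fin m) ℝ) (t u : ℤ) : Matrix (Fin m) (Fin m) ℝ :=
  coefProd Θ t (t + 1 - u).toNat

/-- The `j`-th term `g(t, t-j+1) Z(t-j)` of the moving average representation. -/
noncomputable def seriesTerm {Ω : Type*} {m : ℕ} (Θ : ℤ → Matrix (Fin m) (Fin m) ℝ)
    (Z : ℤ → Ω → EuclideanSpace ℝ (Fin m)) (t : ℤ) (ω : Ω) (j : ℕ) : EuclideanSpace ℝ (Fin m) :=
  Matrix.toEuclideanLin (gMat Θ t (t - j + 1)) (Z (t - j) ω)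

/-- The product `P_r = θ_rr(1) θ_rr(2) ⋯ θ_rr(T)`. -/
def periodProd {m : ℕ} (Θ : ℤ → Matrix (Fin m) (Fin m) ℝ) (T : ℕ) (r : Fin m) : ℝ :=
  ∏ i ∈ Finset.Icc 1 T, Θ (i : ℤ) r r

/-! The matrices are diagonal, so each component is a scalar moving average: `X_r(t) = ∑ j, a_j
Z_r(t - j)`, where `a_j` is the product of the `j` values of `θ_rr` ending at time `t` (`backProd`).
Periodicity gives `a_{j+T} = P_r a_j`, hence geometric decay. Stable coordinates have tails of order
`x ^ (-α)`, so Borel–Cantelli yields almost sure absolute convergence (`ae_summable_abs_mul_coord`),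
and splitting off the zeroth term gives the autoregression.

For two series `∑ a_j W_j r` and `∑ b_j W_j l` over the same independent noise, characteristic
functions of partial sums factorise, and the limit has exponent `-∑ j, ∫ |θ₀ a_j s_r + θ₁ b_j s_l|^α
Γ(ds)`. The integrand is homogeneous of degree `α` in the planar point `(a_j s_r, b_j s_l)`, so
projecting this point to the circle with weight `‖·‖^α` produces a spectral measure
(`isSpectralMeasure_series`). The function `v₀ v₁^{⟨α-1⟩}` is homogeneous of the same degree;
integrating it gives the covariation `(∑ j, b_j^{⟨α-1⟩} a_j) ∫ s_l^{⟨α-1⟩} s_r Γ(ds)`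
(`covariation_series`).

Different times are aligned by putting zeros in front of the coefficients of the earlier one. The
remaining sum carries the factor leading from the earlier to the later time, and its terms are
multiplied by `P_l^{⟨α-1⟩} P_r` over each period, so it collapses to one period as a geometric
series does. -/

/-! ### Signed powers -/

lemma measurable_signedPow (a : ℝ) : Measurable fun x : ℝ => signedPow x a := by
  have hs : Measurable Real.sign := by
    unfold Real.sign
    exact Measurable.ite measurableSet_Iio measurable_const
      (Measurable.ite measurableSet_Ioi measurable_const measurable_const)
  exact (measurable_id.abs.pow_const a).mul hs

lemma signedPow_mul (x y a : ℝ) : signedPow (x * y) a = signedPow x a * signedPow y a := by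
  have hs : Real.sign (x * y) = Real.sign x * Real.sign y := by
    rcases lt_trichotomy x 0 with hx | rfl | hx <;> rcases lt_trichotomy y 0 with hy | rfl | hy <;>
      simp [Real.sign_of_neg, Real.sign_of_pos, mul_pos_of_neg_of_neg, mul_neg_of_neg_of_pos,
        mul_neg_of_pos_of_neg, *]
  unfold signedPow
  rw [hs, abs_mul, Real.mul_rpow (abs_nonneg _) (abs_nonneg _)]
  ring

lemma abs_signedPow_le (x a : ℝ) : |signedPow x a| ≤ |x| ^ a := by
  have h2 : |Real.sign x| ≤ 1 := by
    rcases Real.sign_apply_eq x with h | h | h <;> simp [h]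
  have h0 : 0 ≤ |x| ^ a := Real.rpow_nonneg (abs_nonneg _) _
  rw [signedPow, abs_mul, abs_of_nonneg h0]
  exact mul_le_of_le_one_right h0 h2

lemma signedPow_zero (a : ℝ) : signedPow 0 a = 0 := by simp [signedPow]

/-- Positivity of `a` matters only at `x = 0`, where the sign forces the value `0` but `0 ^ 0 = 1`.
-/
lemma signedPow_of_nonneg {x a : ℝ} (hx : 0 ≤ x) (ha : 0 < a) : signedPow x a = x ^ a := by
  rcases hx.eq_or_lt with rfl | hx
  · simp [signedPow_zero, Real.zero_rpow ha.ne']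
  · simp [signedPow, Real.sign_of_pos hx, abs_of_pos hx]

/-! ### Products of consecutive values of a periodic sequence -/

/-- The product `d(t) d(t-1) ⋯ d(t-j+1)` of `j` consecutive values of `d` ending at `t`. -/
def backProd (d : ℤ → ℝ) (t : ℤ) (j : ℕ) : ℝ := ∏ i ∈ Finset.range j, d (t - i)

lemma backProd_add (d : ℤ → ℝ) (t : ℤ) (j k : ℕ) :
    backProd d t (j + k) = backProd d t j * backProd d (t - j) k := by
  simp only [backProd, Finset.prod_range_add]
  congr 1
  refine Finset.prod_congr rfl fun i _ => ?_
  congr 1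
  push_cast
  ring

/-- Advancing the window by one gains `d (t + 1)` and loses `d (t + 1 - T)`, which are equal. -/
lemma backProd_succ_period {d : ℤ → ℝ} {T : ℕ} (hd : ∀ t, d (t + T) = d t) (t : ℤ) :
    backProd d (t + 1) T = backProd d t T := by
  cases T with
  | zero => simp [backProd]
  | succ n =>
    have h1 : backProd d (t + 1) (1 + n) = _ := backProd_add d (t + 1) 1 n
    have h2 : backProd d t (n + 1) = _ := backProd_add d t n 1
    rw [add_comm n 1, h1, add_comm 1 n, h2, mul_comm]
    have e1 : backProd d (t + 1) 1 = d (t + 1) := by simp [backProd]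
    have e2 : backProd d (t - n) 1 = d (t - n) := by simp [backProd]
    rw [e1, e2, ← hd (t - n)]
    push_cast
    congr 2 <;> ring_nf

/-- All windows of length `T` have the same product, so the one ending at time `T`, which covers `1,
…, T`, represents them. -/
lemma backProd_period {d : ℤ → ℝ} {T : ℕ} (hd : ∀ t, d (t + T) = d t) (t : ℤ) :
    backProd d t T = ∏ i ∈ Finset.Icc 1 T, d i := by
  have hconst : ∀ t, backProd d t T = backProd d 0 T := by
    intro t
    induction t using Int.induction_on with
    | zero => rfl
    | succ i ih => rw [backProd_succ_period hd, ih]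
    | pred i ih => rw [← ih, ← backProd_succ_period hd, sub_add_cancel]
  have hcount : ∀ n : ℕ, backProd d n n = ∏ i ∈ Finset.Icc 1 n, d i := by
    intro n
    induction n with
    | zero => simp [backProd]
    | succ n ih =>
      rw [Finset.prod_Icc_succ_top (by omega), ← ih]
      have h1 : backProd d ((n + 1 : ℕ) : ℤ) (1 + n) = _ := backProd_add d ((n + 1 : ℕ) : ℤ) 1 n
      rw [add_comm 1 n] at h1
      rw [h1, mul_comm]
      congr 1
      · congr 1
        push_cast
        ring
      · simp [backProd]
  rw [hconst, ← hconst T, hcount]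

/-- A sequence with `c (j + T) = q c j`, `|q| < 1`, decays geometrically. -/
lemma exists_geometric_bound {c : ℕ → ℝ} {T : ℕ} (hT : 0 < T) {q : ℝ} (hq : |q| < 1)
    (hc : ∀ j, c (j + T) = q * c j) :
    ∃ ρ C : ℝ, 0 < ρ ∧ ρ < 1 ∧ 0 ≤ C ∧ ∀ j, |c j| ≤ C * ρ ^ j := by
  -- The maximum with `1 / 2` keeps `ρ` positive when `q = 0`.
  set p := max |q| (1 / 2) with hp
  have hp0 : 0 < p := lt_max_of_lt_right (by norm_num)
  have hp1 : p < 1 := max_lt hq (by norm_num)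
  have hTR : (0 : ℝ) < T := by exact_mod_cast hT
  set ρ := p ^ (1 / (T : ℝ))
  have hρ0 : 0 < ρ := Real.rpow_pos_of_pos hp0 _
  have hρ1 : ρ < 1 := Real.rpow_lt_one hp0.le hp1 (by positivity)
  have hρT : ρ ^ T = p := by
    rw [← Real.rpow_natCast, ← Real.rpow_mul hp0.le, one_div_mul_cancel hTR.ne', Real.rpow_one]
  -- This constant dominates `|c k| / ρ ^ k` over the first period; `|q| ≤ p = ρ ^ T` propagates the
  -- bound.
  refine ⟨ρ, ∑ k ∈ Finset.range T, |c k| / ρ ^ k, hρ0, hρ1,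
    Finset.sum_nonneg fun k _ => by positivity, fun j => ?_⟩
  induction j using Nat.strong_induction_on with
  | _ j ih =>
    rcases lt_or_ge j T with hj | hj
    · have h := Finset.single_le_sum (f := fun k => |c k| / ρ ^ k)
        (fun k _ => by positivity) (Finset.mem_range.mpr hj)
      rwa [div_le_iff₀ (by positivity)] at h
    · obtain ⟨i, rfl⟩ := Nat.exists_eq_add_of_le' hj
      have h := ih i (by omega)
      rw [hc, abs_mul, pow_add, hρT, ← mul_assoc, mul_comm]
      exact mul_le_mul h (le_max_left _ _) (abs_nonneg _) ((abs_nonneg _).trans h)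

/-- Dropping the first `T` terms multiplies the sum `S` by `q`, so `S` is the first block plus `q
S`. -/
lemma tsum_eq_sum_range_div {c : ℕ → ℝ} {T : ℕ} {q : ℝ} (hq : q ≠ 1)
    (hc : ∀ j, c (j + T) = q * c j) (hs : Summable c) :
    ∑' j, c j = (∑ k ∈ Finset.range T, c k) / (1 - q) := by
  have h := hs.sum_add_tsum_nat_add T
  simp_rw [hc, tsum_mul_left] at h
  rw [eq_div_iff (sub_ne_zero.mpr hq.symm)]
  linarith

/-! ### Diagonal coefficient matrices and the terms of the series -/

section Coefficients

variable {m T : ℕ} {Θ : ℤ → Matrix (Fin m) (Fin m) ℝ}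

lemma coefProd_eq_diagonal (hdiag : ∀ t, ∀ r l : Fin m, r ≠ l → Θ t r l = 0) (t : ℤ) (j : ℕ) :
    coefProd Θ t j = Matrix.diagonal fun r => backProd (fun u => Θ u r r) t j := by
  have hΘ : ∀ t, Θ t = Matrix.diagonal fun r => Θ t r r := by
    intro t
    ext r l
    rcases eq_or_ne r l with rfl | h
    · simp
    · simp [h, hdiag t r l h]
  induction j with
  | zero => simp [coefProd, backProd]
  | succ j ih =>
    rw [coefProd, ih, hΘ, Matrix.diagonal_mul_diagonal]
    simp [backProd, Finset.prod_range_succ]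

lemma gMat_natCast (t : ℤ) (j : ℕ) : gMat Θ t (t - j + 1) = coefProd Θ t j := by
  rw [gMat]
  congr 1
  omega

/-- The recursion peels off the oldest factor on the right; the autoregression needs the newest one
on the left. -/
lemma coefProd_succ' (t : ℤ) (j : ℕ) : coefProd Θ t (j + 1) = Θ t * coefProd Θ (t - 1) j := by
  induction j with
  | zero => simp [coefProd]
  | succ j ih =>
    rw [coefProd, ih, coefProd, mul_assoc]
    congr 3
    push_cast
    ring

lemma gMat_shift (hper : ∀ t, Θ (t + T) = Θ t) (t u : ℤ) :
    gMat Θ (t + T) (u + T) = gMat Θ t u := by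
  have h : ∀ j, coefProd Θ (t + T) j = coefProd Θ t j := by
    intro j
    induction j with
    | zero => rfl
    | succ j ih =>
      rw [coefProd, coefProd, ih, ← hper (t - j)]
      congr 2
      ring
  rw [gMat, gMat, h]
  congr 1
  omega

lemma seriesTerm_apply {Ω : Type*} (hdiag : ∀ t, ∀ r l : Fin m, r ≠ l → Θ t r l = 0)
    (Z : ℤ → Ω → EuclideanSpace ℝ (Fin m)) (t : ℤ) (ω : Ω) (j : ℕ) (r : Fin m) :
    seriesTerm Θ Z t ω j r = backProd (fun u => Θ u r r) t j * Z (t - j) ω r := by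
  rw [seriesTerm, gMat_natCast, coefProd_eq_diagonal hdiag]
  simp [Matrix.toLpLin_apply, Matrix.mulVec_diagonal]

lemma seriesTerm_zero {Ω : Type*} (Z : ℤ → Ω → EuclideanSpace ℝ (Fin m)) (t : ℤ) (ω : Ω) :
    seriesTerm Θ Z t ω 0 = Z t ω := by
  rw [seriesTerm, gMat_natCast]
  simp [coefProd]

lemma seriesTerm_succ {Ω : Type*} (Z : ℤ → Ω → EuclideanSpace ℝ (Fin m)) (t : ℤ) (ω : Ω) (j : ℕ) :
    seriesTerm Θ Z t ω (j + 1) = Matrix.toEuclideanLin (Θ t) (seriesTerm Θ Z (t - 1) ω j) := by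
  rw [seriesTerm, seriesTerm, gMat_natCast, gMat_natCast, coefProd_succ']
  have h : t - ((j + 1 : ℕ) : ℤ) = t - 1 - j := by push_cast; ring
  rw [h]
  simp [Matrix.toLpLin_apply, Matrix.mulVec_mulVec]

end Coefficients

/-! ### Radial projection of a measure to the sphere -/

section AngularMeasure

variable {E : Type*} [NormedAddCommGroup E] [NormedSpace ℝ E]

open Classical in
/-- The radial projection of a nonzero vector to the unit sphere; `0` is sent to `e`. -/
noncomputable def sphereProj (e : Metric.sphere (0 : E) 1) (v : E) : Metric.sphere (0 : E) 1 :=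
  ⟨if v = 0 then e else ‖v‖⁻¹ • v, by
    split_ifs with h
    · exact e.2
    · simp [norm_smul, h]⟩

lemma norm_smul_sphereProj (e : Metric.sphere (0 : E) 1) (v : E) :
    ‖v‖ • (sphereProj e v : E) = v := by
  by_cases h : v = 0
  · simp [h]
  · simp [sphereProj, h, smul_smul]

lemma sphereProj_neg (e : Metric.sphere (0 : E) 1) {v : E} (hv : v ≠ 0) :
    sphereProj e (-v) = -sphereProj e v := by
  ext
  simp [sphereProj, hv]

variable [MeasurableSpace E] [BorelSpace E] [SecondCountableTopology E]

lemma measurable_sphereProj (e : Metric.sphere (0 : E) 1) : Measurable (sphereProj e) := by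
  refine Measurable.subtype_mk ?_
  exact Measurable.ite (measurableSet_singleton 0) measurable_const
    (measurable_norm.inv.smul measurable_id)

variable {Y : Type*} [MeasurableSpace Y]

/-- The measure on the sphere with `∫ H dν = ∫ H(f y) dκ(y)` for all `H` that are positively
homogeneous of degree `α`. -/
noncomputable def angularMeasure (α : ℝ) (e : Metric.sphere (0 : E) 1) (κ : Measure Y) (f : Y → E) :
    Measure (Metric.sphere (0 : E) 1) :=
  (κ.withDensity fun y => ENNReal.ofReal (‖f y‖ ^ α)).map fun y => sphereProj e (f y)

variable {α : ℝ} (e : Metric.sphere (0 : E) 1) {κ : Measure Y} {f : Y → E}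

lemma lintegral_angularMeasure (hf : Measurable f) {g : Metric.sphere (0 : E) 1 → ENNReal}
    (hg : Measurable g) :
    ∫⁻ s, g s ∂(angularMeasure α e κ f)
      = ∫⁻ y, ENNReal.ofReal (‖f y‖ ^ α) * g (sphereProj e (f y)) ∂κ := by
  have hp : Measurable fun y => sphereProj e (f y) := (measurable_sphereProj e).comp hf
  rw [angularMeasure, lintegral_map hg hp]
  exact lintegral_withDensity_eq_lintegral_mul _ (by fun_prop) (hg.comp hp)

lemma isFiniteMeasure_angularMeasure (hf : Measurable f)
    (hint : Integrable (fun y => ‖f y‖ ^ α) κ) : IsFiniteMeasure (angularMeasure α e κ f) := by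
  refine ⟨?_⟩
  rw [← lintegral_one, lintegral_angularMeasure e hf measurable_const]
  simpa using hint.lintegral_lt_top

/-- The density `‖f y‖ ^ α` restores exactly the factor that projecting `f y` to the sphere removes
from `H`. -/
lemma integral_angularMeasure (hf : Measurable f) {H : E → ℝ} (hHm : Measurable H)
    (hH : ∀ c : ℝ, 0 ≤ c → ∀ v, H (c • v) = c ^ α * H v) :
    ∫ s, H (s : E) ∂(angularMeasure α e κ f) = ∫ y, H (f y) ∂κ := by
  have hp : Measurable fun y => sphereProj e (f y) := (measurable_sphereProj e).comp hf
  have hHs : Measurable fun s : Metric.sphere (0 : E) 1 => H s := hHm.comp measurable_subtype_coe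
  rw [angularMeasure, integral_map hp.aemeasurable hHs.aestronglyMeasurable,
    integral_withDensity_eq_integral_toReal_smul (by fun_prop)
      (Filter.Eventually.of_forall fun _ => ENNReal.ofReal_lt_top)]
  refine integral_congr_ae (Filter.Eventually.of_forall fun y => ?_)
  simp only
  rw [ENNReal.toReal_ofReal (Real.rpow_nonneg (norm_nonneg _) _), smul_eq_mul,
    ← hH _ (norm_nonneg _), norm_smul_sphereProj]

/-- An oddness of `f` under a symmetry of `κ` becomes a symmetry on the sphere. The projection is
not odd at `0`, but there the density `0 ^ α` vanishes. -/
lemma angularMeasure_map_neg (hα : α ≠ 0) (hf : Measurable f) {σ : Y → Y} (hσ : Measurable σ)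
    (hκ : κ.map σ = κ) (hfσ : ∀ y, f (σ y) = -f y) :
    (angularMeasure α e κ f).map (fun s => -s) = angularMeasure α e κ f := by
  have hneg : Measurable fun s : Metric.sphere (0 : E) 1 => -s :=
    Measurable.subtype_mk measurable_subtype_coe.neg
  have hp : Measurable fun y => sphereProj e (f y) := (measurable_sphereProj e).comp hf
  refine Measure.ext_of_lintegral _ fun g hg => ?_
  have hgn : Measurable fun s => g (-s) := hg.comp hneg
  rw [lintegral_map hg hneg, lintegral_angularMeasure e hf hgn,
    lintegral_angularMeasure e hf hg]
  conv_rhs => rw [← hκ, lintegral_map (by fun_prop) hσ]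
  refine lintegral_congr fun y => ?_
  rw [hfσ, norm_neg]
  by_cases h : f y = 0
  · simp [h, Real.zero_rpow hα]
  · rw [sphereProj_neg e h]

end AngularMeasure

/-! ### Series of integrals as one integral -/

section SumMeasure

variable {S : Type*} [MeasurableSpace S]

/-- Integrals with respect to the product of the counting measure on `ℕ` and `Γ`. -/
lemma hasSum_integral_count_prod {Γ : Measure S} [IsFiniteMeasure Γ] {F : ℕ → S → ℝ}
    (hF : ∀ j, Measurable (F j)) {u : ℕ → ℝ} (hu : Summable u) (hFu : ∀ j s, |F j s| ≤ u j) :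
    Integrable (fun y : ℕ × S => F y.1 y.2) (Measure.count.prod Γ) ∧
    HasSum (fun j => ∫ s, F j s ∂Γ) (∫ y, F y.1 y.2 ∂(Measure.count.prod Γ)) := by
  have hm : Measurable fun y : ℕ × S => F y.1 y.2 := measurable_from_prod_countable_right hF
  have hbd : ∀ j, ∫ s, ‖F j s‖ ∂Γ ≤ u j * Γ.real Set.univ := by
    intro j
    calc ∫ s, ‖F j s‖ ∂Γ ≤ ∫ _, u j ∂Γ := by
          refine integral_mono_of_nonneg (Filter.Eventually.of_forall fun _ => norm_nonneg _)
            (integrable_const _) (Filter.Eventually.of_forall (hFu j))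
      _ = _ := by simp [mul_comm]
  have hi : Integrable (fun y : ℕ × S => F y.1 y.2) (Measure.count.prod Γ) := by
    rw [integrable_prod_iff hm.aestronglyMeasurable]
    refine ⟨Filter.Eventually.of_forall fun j =>
      Integrable.of_bound (hF j).aestronglyMeasurable (u j)
        (Filter.Eventually.of_forall (hFu j)), ?_⟩
    rw [integrable_count_iff]
    refine Summable.of_nonneg_of_le (fun _ => norm_nonneg _) (fun j => ?_)
      (hu.mul_right (Γ.real Set.univ))
    rw [Real.norm_of_nonneg (integral_nonneg fun _ => norm_nonneg _)]
    exact hbd j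
  refine ⟨hi, ?_⟩
  have hs : Summable fun j => ∫ s, F j s ∂Γ := by
    refine Summable.of_norm_bounded (hu.mul_right (Γ.real Set.univ)) fun j => ?_
    exact (norm_integral_le_integral_norm _).trans (hbd j)
  rw [integral_prod _ hi, integral_countable hi.integral_prod_left]
  simpa using hs.hasSum

end SumMeasure

/-! ### Stable tails and almost sure convergence -/

section Tail

variable {Ω : Type*} [MeasurableSpace Ω] {μ : Measure Ω} [IsProbabilityMeasure μ] {d : ℕ} {α : ℝ}

/-- The coordinates of a symmetric `α`-stable vector have tails of order `r ^ (-α)`. -/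
lemma IsSpectralMeasure.measureReal_coord_gt_le {V : Ω → EuclideanSpace ℝ (Fin d)}
    {Γ : Measure (Metric.sphere (0 : EuclideanSpace ℝ (Fin d)) 1)} (hα : 1 < α)
    (h : IsSpectralMeasure α μ V Γ) (i : Fin d) {r : ℝ} (hr : 0 < r) :
    μ.real {ω | r < |V ω i|} ≤ 2 * Γ.real Set.univ * (2 * r⁻¹) ^ α := by
  have := h.finite
  have := Measure.isProbabilityMeasure_map (μ := μ) h.aemeasurable
  set a : EuclideanSpace ℝ (Fin d) := EuclideanSpace.single i 1
  have hset : μ.real {ω | r < |V ω i|} = (μ.map V).real {x | r < |inner ℝ a x|} := by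
    rw [map_measureReal_apply_of_aemeasurable h.aemeasurable]
    · simp [a, EuclideanSpace.inner_single_left]
    · exact measurableSet_lt measurable_const (by fun_prop)
  rw [hset]
  -- Here `1 - charFun` equals `1 - exp (-J) ≤ J`, and `|t s_i| ≤ 2 / r` on the sphere bounds `J`.
  have hbound : ∀ t ∈ Set.uIoc (-2 * r⁻¹) (2 * r⁻¹),
      ‖1 - charFun (μ.map V) (t • a)‖ ≤ Γ.real Set.univ * (2 * r⁻¹) ^ α := by
    intro t ht
    have ht' : |t| ≤ 2 * r⁻¹ := by
      have hr' : 0 < r⁻¹ := by positivity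
      rw [Set.uIoc_of_le (by linarith)] at ht
      exact abs_le.mpr ⟨by linarith [ht.1], ht.2⟩
    rw [h.charFun_eq]
    set J := ∫ s, |inner ℝ (t • a) (s : EuclideanSpace ℝ (Fin d))| ^ α ∂Γ
    have hJ0 : 0 ≤ J := integral_nonneg fun s => Real.rpow_nonneg (abs_nonneg _) _
    have hJ : J ≤ Γ.real Set.univ * (2 * r⁻¹) ^ α := by
      calc J ≤ ∫ _, (2 * r⁻¹) ^ α ∂Γ := by
            refine integral_mono_of_nonneg
              (Filter.Eventually.of_forall fun s => Real.rpow_nonneg (abs_nonneg _) _)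
              (integrable_const _) (Filter.Eventually.of_forall fun s => ?_)
            refine Real.rpow_le_rpow (abs_nonneg _) ?_ (by linarith)
            have hs := abs_coord_le_one s i
            rw [inner_smul_left, abs_mul]
            simp only [a, EuclideanSpace.inner_single_left, map_one, one_mul]
            calc |t| * |s.1 i| ≤ 2 * r⁻¹ * 1 := by gcongr
              _ = _ := mul_one _
        _ = _ := by simp
    rw [← Complex.ofReal_neg, ← Complex.ofReal_exp, ← Complex.ofReal_one, ← Complex.ofReal_sub,
      Complex.norm_real, Real.norm_of_nonneg (by simpa using hJ0)]
    linarith [Real.add_one_le_exp (-J)]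
  have hI := intervalIntegral.norm_integral_le_of_norm_le_const hbound
  have hlen : |2 * r⁻¹ - -2 * r⁻¹| = 4 * r⁻¹ := by
    rw [abs_of_nonneg] <;> ring_nf; positivity
  rw [hlen] at hI
  calc _ ≤ 2⁻¹ * r * ‖∫ t in -2 * r⁻¹..2 * r⁻¹, 1 - charFun (μ.map V) (t • a)‖ :=
        measureReal_abs_inner_gt_le_integral_charFun hr
    _ ≤ 2⁻¹ * r * (Γ.real Set.univ * (2 * r⁻¹) ^ α * (4 * r⁻¹)) := by gcongr
    _ = _ := by field_simp; ring

/-- Stable random variables multiplied by geometrically decaying coefficients are absolutely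
summable almost surely. -/
lemma ae_summable_abs_mul_coord {W : ℕ → Ω → EuclideanSpace ℝ (Fin d)}
    {Γ : Measure (Metric.sphere (0 : EuclideanSpace ℝ (Fin d)) 1)} (hα : 1 < α)
    (hW : ∀ j, IsSpectralMeasure α μ (W j) Γ) (i : Fin d) {c : ℕ → ℝ} {ρ C : ℝ} (hρ0 : 0 < ρ)
    (hρ1 : ρ < 1) (hC : 0 ≤ C) (hc : ∀ j, |c j| ≤ C * ρ ^ j) :
    ∀ᵐ ω ∂μ, Summable fun j => |c j * W j ω i| := by
  -- The decay `ρ ^ j = σ ^ j * σ ^ j` is split in two: by Borel–Cantelli `|W j ω i| ≤ (σ ^ j)⁻¹`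
  -- eventually, which uses up one factor and leaves a convergent geometric series.
  set σ := Real.sqrt ρ
  have hσ0 : 0 < σ := Real.sqrt_pos.mpr hρ0
  have hσ1 : σ < 1 := by rw [Real.sqrt_lt' one_pos]; simpa using hρ1
  have hσρ : ρ = σ * σ := (Real.mul_self_sqrt hρ0.le).symm
  have hσα : σ ^ α < 1 := Real.rpow_lt_one hσ0.le hσ1 (by linarith)
  have hσα0 : 0 ≤ σ ^ α := Real.rpow_nonneg hσ0.le _
  set K := 2 * Γ.real Set.univ * 2 ^ α
  have htail : ∀ j, μ.real {ω | (σ ^ j)⁻¹ < |W j ω i|} ≤ K * (σ ^ α) ^ j := by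
    intro j
    refine ((hW j).measureReal_coord_gt_le hα i (by positivity)).trans_eq ?_
    rw [inv_inv, Real.mul_rpow (by norm_num) (by positivity), ← Real.rpow_natCast,
      ← Real.rpow_natCast, ← Real.rpow_mul hσ0.le, ← Real.rpow_mul hσ0.le, mul_comm (j : ℝ) α]
    ring
  have hsum : Summable fun j : ℕ => K * (σ ^ α) ^ j :=
    (summable_geometric_of_lt_one hσα0 hσα).mul_left K
  have hfin : ∑' j, μ {ω | (σ ^ j)⁻¹ < |W j ω i|} ≠ ⊤ := by
    refine ne_top_of_le_ne_top hsum.tsum_ofReal_ne_top (ENNReal.tsum_le_tsum fun j => ?_)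
    rw [← ofReal_measureReal]
    exact ENNReal.ofReal_le_ofReal (htail j)
  filter_upwards [ae_eventually_notMem hfin] with ω hω
  refine Summable.of_norm_bounded_eventually_nat
    ((summable_geometric_of_lt_one hσ0.le hσ1).mul_left C) ?_
  filter_upwards [hω] with j hj
  have hj' : |W j ω i| ≤ (σ ^ j)⁻¹ := not_lt.mp hj
  rw [Real.norm_eq_abs, abs_abs, abs_mul]
  calc |c j| * |W j ω i| ≤ C * ρ ^ j * (σ ^ j)⁻¹ := by
        gcongr
        exact hc j
    _ = C * σ ^ j := by
        rw [hσρ, mul_pow]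
        field_simp

end Tail

/-! ### Homogeneous functions of degree `α` -/

section Homogeneous

lemma rpow_abs_inner_smul {d : ℕ} {α : ℝ} (θ : EuclideanSpace ℝ (Fin d)) {c : ℝ} (hc : 0 ≤ c)
    (v : EuclideanSpace ℝ (Fin d)) :
    |inner ℝ θ (c • v)| ^ α = c ^ α * |inner ℝ θ v| ^ α := by
  rw [inner_smul_right, abs_mul, abs_of_nonneg hc, Real.mul_rpow hc (abs_nonneg _)]

/-- Degrees `1` and `α - 1` add up to `α`, which makes the covariation integrand admissible in
`integral_angularMeasure`. -/
lemma mul_signedPow_smul {α : ℝ} (hα : 1 < α) {c : ℝ} (hc : 0 ≤ c)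
    (v : EuclideanSpace ℝ (Fin 2)) :
    (c • v) 0 * signedPow ((c • v) 1) (α - 1) = c ^ α * (v 0 * signedPow (v 1) (α - 1)) := by
  have h : c ^ α = c * c ^ (α - 1) := by
    rw [← Real.rpow_one_add' hc (by linarith)]
    congr 1
    ring
  simp only [PiLp.smul_apply, smul_eq_mul]
  rw [signedPow_mul, signedPow_of_nonneg hc (by linarith), h]
  ring

lemma abs_mul_signedPow_le {α : ℝ} (hα : 1 < α) (v : EuclideanSpace ℝ (Fin 2)) :
    |v 0 * signedPow (v 1) (α - 1)| ≤ ‖v‖ ^ α := by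
  have h : ‖v‖ ^ α = ‖v‖ * ‖v‖ ^ (α - 1) := by
    rw [← Real.rpow_one_add' (norm_nonneg _) (by linarith)]
    congr 1
    ring
  rw [abs_mul, h]
  have h0 : |v 0| ≤ ‖v‖ := PiLp.norm_apply_le v 0
  have h1 : |v 1| ≤ ‖v‖ := PiLp.norm_apply_le v 1
  gcongr
  exact (abs_signedPow_le _ _).trans (Real.rpow_le_rpow (abs_nonneg _) h1 (by linarith))

/-- The terms are eventually at most `1`, where `x ^ α ≤ x`. -/
lemma summable_rpow_of_summable {x : ℕ → ℝ} (hx : ∀ j, 0 ≤ x j) (hs : Summable x) {α : ℝ}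
    (hα : 1 ≤ α) : Summable fun j => x j ^ α := by
  refine Summable.of_norm_bounded_eventually_nat hs ?_
  filter_upwards [hs.tendsto_atTop_zero.eventually_le_const one_pos] with j hj
  rw [Real.norm_of_nonneg (Real.rpow_nonneg (hx j) _)]
  exact Real.rpow_le_self_of_le_one (hx j) hj hα

end Homogeneous

/-! ### Joint law and covariation of two series over the same noise -/

section Series

variable {d : ℕ}

/-- The point `(a s_r, b s_l)` of the plane. -/
noncomputable def coordPair (r l : Fin d) (a b : ℝ)
    (s : Metric.sphere (0 : EuclideanSpace ℝ (Fin d)) 1) : EuclideanSpace ℝ (Fin 2) :=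
  !₂[a * s.1 r, b * s.1 l]

lemma measurable_coordPair (r l : Fin d) (a b : ℝ) : Measurable (coordPair r l a b) := by
  have : Continuous (coordPair r l a b) := by
    unfold coordPair
    fun_prop
  exact this.measurable

lemma norm_coordPair_le (r l : Fin d) (a b : ℝ)
    (s : Metric.sphere (0 : EuclideanSpace ℝ (Fin d)) 1) :
    ‖coordPair r l a b s‖ ≤ |a| + |b| := by
  have h : coordPair r l a b s = (a * s.1 r) • EuclideanSpace.single (0 : Fin 2) (1 : ℝ)
      + (b * s.1 l) • EuclideanSpace.single (1 : Fin 2) (1 : ℝ) := by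
    ext i
    fin_cases i <;> simp [coordPair]
  rw [h]
  refine (norm_add_le _ _).trans ?_
  have h1 : ∀ i : Fin 2, ‖EuclideanSpace.single i (1 : ℝ)‖ = 1 := fun i => by simp
  rw [norm_smul, norm_smul, h1, h1, mul_one, mul_one, Real.norm_eq_abs, Real.norm_eq_abs, abs_mul,
    abs_mul]
  gcongr
  · exact mul_le_of_le_one_right (abs_nonneg _) (abs_coord_le_one s r)
  · exact mul_le_of_le_one_right (abs_nonneg _) (abs_coord_le_one s l)

lemma coordPair_neg (r l : Fin d) (a b : ℝ)
    (s : Metric.sphere (0 : EuclideanSpace ℝ (Fin d)) 1) :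
    coordPair r l a b (-s) = -coordPair r l a b s := by
  ext i
  fin_cases i <;> simp [coordPair]

/-- The spectral measure of `(∑ a_j W_j r, ∑ b_j W_j l)` for independent `W_j ∼ S_α(Γ)`. -/
noncomputable def seriesSpectralMeasure (α : ℝ) (r l : Fin d) (a b : ℕ → ℝ)
    (Γ : Measure (Metric.sphere (0 : EuclideanSpace ℝ (Fin d)) 1)) :
    Measure (Metric.sphere (0 : EuclideanSpace ℝ (Fin 2)) 1) :=
  angularMeasure α ⟨EuclideanSpace.single 0 1, by simp⟩ (Measure.count.prod Γ)
    fun y : ℕ × Metric.sphere (0 : EuclideanSpace ℝ (Fin d)) 1 => coordPair r l (a y.1) (b y.1) y.2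

variable {α : ℝ} {r l : Fin d} {a b : ℕ → ℝ}
  {Γ : Measure (Metric.sphere (0 : EuclideanSpace ℝ (Fin d)) 1)}

lemma measurable_coordPair_prod :
    Measurable fun y : ℕ × Metric.sphere (0 : EuclideanSpace ℝ (Fin d)) 1 =>
      coordPair r l (a y.1) (b y.1) y.2 :=
  measurable_from_prod_countable_right fun j => measurable_coordPair r l (a j) (b j)

/-- The characteristic function of a finite sum `∑ ⟪c_j, W_j⟫`. -/
lemma integral_cexp_sum_inner {Ω : Type*} [MeasurableSpace Ω] {μ : Measure Ω}
    {W : ℕ → Ω → EuclideanSpace ℝ (Fin d)}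
    (hW : ∀ j, IsSpectralMeasure α μ (W j) Γ) (hind : iIndepFun W μ)
    (c : ℕ → EuclideanSpace ℝ (Fin d)) (n : ℕ) :
    ∫ ω, Complex.exp (((∑ j ∈ Finset.range n, inner ℝ (W j ω) (c j) : ℝ) : ℂ) * Complex.I) ∂μ
      = Complex.exp (-((∑ j ∈ Finset.range n,
          ∫ s, |inner ℝ (c j) (s : EuclideanSpace ℝ (Fin d))| ^ α ∂Γ : ℝ) : ℂ)) := by
  set U : ℕ → Ω → ℝ := fun j ω => inner ℝ (W j ω) (c j)
  have hUm : ∀ j, AEMeasurable (U j) μ := fun j => (hW j).aemeasurable.inner aemeasurable_const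
  have hUind : iIndepFun U μ :=
    hind.comp (g := fun j v => inner ℝ v (c j)) fun j => by fun_prop
  -- At argument `1` the characteristic function of the real variable `⟪W_j, c_j⟫` is that of `W_j`
  -- at `c_j`.
  have hprod := congrFun (iIndepFun.charFun_map_fun_finsetSum_eq_prod (s := Finset.range n)
    (fun j _ => hUm j) (hUind.restrict _)) 1
  have hone : ∀ j, charFun (μ.map (U j)) 1 = charFun (μ.map (W j)) (c j) := by
    intro j
    rw [charFun_apply, charFun_apply, integral_map (hUm j) (by fun_prop),
      integral_map (hW j).aemeasurable (by fun_prop)]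
    simp [U]
  rw [Finset.prod_apply] at hprod
  simp_rw [hone, (hW _).charFun_eq] at hprod
  rw [← Complex.exp_sum] at hprod
  rw [charFun_apply, integral_map (Finset.aemeasurable_fun_sum _ fun j _ => hUm j)
    (by fun_prop)] at hprod
  rw [Complex.ofReal_sum, ← Finset.sum_neg_distrib, ← hprod]
  simp [U]

variable [IsFiniteMeasure Γ]

/-- Integrals of homogeneous functions against the spectral measure of the series. -/
lemma hasSum_integral_seriesSpectralMeasure (hα : 1 < α) (ha : Summable fun j => |a j|)
    (hb : Summable fun j => |b j|) {H : EuclideanSpace ℝ (Fin 2) → ℝ} (hHm : Measurable H)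
    (hH : ∀ c : ℝ, 0 ≤ c → ∀ v, H (c • v) = c ^ α * H v) {K : ℝ}
    (hK : ∀ v, |H v| ≤ K * ‖v‖ ^ α) :
    HasSum (fun j => ∫ s, H (coordPair r l (a j) (b j) s) ∂Γ)
      (∫ s, H s ∂(seriesSpectralMeasure α r l a b Γ)) := by
  have hu : Summable fun j => |K| * (|a j| + |b j|) ^ α :=
    (summable_rpow_of_summable (fun j => by positivity) (ha.add hb) hα.le).mul_left _
  rw [seriesSpectralMeasure, integral_angularMeasure _ measurable_coordPair_prod hHm hH]
  refine (hasSum_integral_count_prod (F := fun j s => H (coordPair r l (a j) (b j) s))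
    (fun j => hHm.comp (measurable_coordPair r l _ _)) hu fun j s => ?_).2
  refine (hK _).trans (mul_le_mul (le_abs_self K) ?_ (by positivity) (abs_nonneg _))
  exact Real.rpow_le_rpow (norm_nonneg _) (norm_coordPair_le r l _ _ s) (by linarith)

lemma isFiniteMeasure_seriesSpectralMeasure (hα : 1 < α) (ha : Summable fun j => |a j|)
    (hb : Summable fun j => |b j|) : IsFiniteMeasure (seriesSpectralMeasure α r l a b Γ) := by
  refine isFiniteMeasure_angularMeasure _ measurable_coordPair_prod ?_
  refine (hasSum_integral_count_prod (F := fun j s => ‖coordPair r l (a j) (b j) s‖ ^ α)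
    (fun j => (measurable_coordPair r l _ _).norm.pow_const α)
    (summable_rpow_of_summable (fun j => by positivity) (ha.add hb) hα.le) fun j s => ?_).1
  rw [abs_of_nonneg (by positivity)]
  exact Real.rpow_le_rpow (norm_nonneg _) (norm_coordPair_le r l _ _ s) (by linarith)

lemma seriesSpectralMeasure_map_neg (hα : 1 < α) (hΓ : Γ.map (fun s => -s) = Γ) :
    (seriesSpectralMeasure α r l a b Γ).map (fun s => -s) = seriesSpectralMeasure α r l a b Γ := by
  have hneg : Measurable fun s : Metric.sphere (0 : EuclideanSpace ℝ (Fin d)) 1 => -s :=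
    Measurable.subtype_mk measurable_subtype_coe.neg
  refine angularMeasure_map_neg _ (by linarith) measurable_coordPair_prod
    (σ := Prod.map id fun s => -s) (measurable_id.prodMap hneg) ?_
    fun y => coordPair_neg r l _ _ y.2
  rw [← Measure.map_prod_map _ _ measurable_id hneg, hΓ, Measure.map_id]

lemma integral_mul_signedPow_seriesSpectralMeasure (hα : 1 < α) (ha : Summable fun j => |a j|)
    (hb : Summable fun j => |b j|) :
    ∫ s, (s : EuclideanSpace ℝ (Fin 2)) 0 * signedPow ((s : EuclideanSpace ℝ (Fin 2)) 1) (α - 1)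
        ∂(seriesSpectralMeasure α r l a b Γ)
      = (∑' j, signedPow (b j) (α - 1) * a j)
        * ∫ x, signedPow ((x : EuclideanSpace ℝ (Fin d)) l) (α - 1)
            * (x : EuclideanSpace ℝ (Fin d)) r ∂Γ := by
  have hm : Measurable fun v : EuclideanSpace ℝ (Fin 2) => v 0 * signedPow (v 1) (α - 1) := by
    refine Measurable.mul (by fun_prop) ((measurable_signedPow _).comp (by fun_prop))
  rw [← (hasSum_integral_seriesSpectralMeasure hα ha hb hm
    (fun c hc v => mul_signedPow_smul hα hc v) (K := 1)
    (fun v => by simpa using abs_mul_signedPow_le hα v)).tsum_eq, ← tsum_mul_right]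
  refine tsum_congr fun j => ?_
  rw [← integral_const_mul]
  refine integral_congr_ae (Filter.Eventually.of_forall fun s => ?_)
  simp [coordPair, signedPow_mul]
  ring

variable {Ω : Type*} [MeasurableSpace Ω] {μ : Measure Ω} [IsProbabilityMeasure μ]

/-- Two series in the coordinates of independent symmetric `α`-stable vectors are jointly
symmetric `α`-stable. -/
theorem isSpectralMeasure_series (hα : 1 < α) {W : ℕ → Ω → EuclideanSpace ℝ (Fin d)}
    (hW : ∀ j, IsSpectralMeasure α μ (W j) Γ) (hind : iIndepFun W μ)
    (ha : Summable fun j => |a j|) (hb : Summable fun j => |b j|) {X Y : Ω → ℝ}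
    (hX : ∀ᵐ ω ∂μ, HasSum (fun j => a j * W j ω r) (X ω))
    (hY : ∀ᵐ ω ∂μ, HasSum (fun j => b j * W j ω l) (Y ω)) :
    IsSpectralMeasure α μ (pairVec X Y) (seriesSpectralMeasure α r l a b Γ) := by
  have hcoord : ∀ (c : ℕ → ℝ) (i : Fin d) (n : ℕ),
      AEMeasurable (fun ω => ∑ j ∈ Finset.range n, c j * W j ω i) μ := by
    intro c i n
    refine Finset.aemeasurable_fun_sum _ fun j _ => ?_
    have hi : Measurable fun v : EuclideanSpace ℝ (Fin d) => c j * v i := by fun_prop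
    exact hi.comp_aemeasurable (hW j).aemeasurable
  have hXm : AEMeasurable X μ := aemeasurable_of_tendsto_metrizable_ae Filter.atTop (hcoord a r)
    (hX.mono fun ω h => h.tendsto_sum_nat)
  have hYm : AEMeasurable Y μ := aemeasurable_of_tendsto_metrizable_ae Filter.atTop (hcoord b l)
    (hY.mono fun ω h => h.tendsto_sum_nat)
  have hpm : AEMeasurable (pairVec X Y) μ := by
    have hg : Continuous fun p : ℝ × ℝ => (!₂[p.1, p.2] : EuclideanSpace ℝ (Fin 2)) := by fun_prop
    exact hg.measurable.comp_aemeasurable (hXm.prodMk hYm)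
  refine ⟨hpm, isFiniteMeasure_seriesSpectralMeasure hα ha hb,
    seriesSpectralMeasure_map_neg hα (hW 0).symmetric, fun θ => ?_⟩
  -- Chosen so that `θ₀ X + θ₁ Y` is the sum of the `⟪W_j, c_j⟫`.
  set c : ℕ → EuclideanSpace ℝ (Fin d) := fun j =>
    (θ 0 * a j) • EuclideanSpace.single r (1 : ℝ) + (θ 1 * b j) • EuclideanSpace.single l (1 : ℝ)
  have hcl : ∀ j (v : EuclideanSpace ℝ (Fin d)),
      inner ℝ v (c j) = θ 0 * (a j * v r) + θ 1 * (b j * v l) := by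
    intro j v
    simp only [c, inner_add_right, inner_smul_right, EuclideanSpace.inner_single_right]
    simp
    ring
  have hlim : Filter.Tendsto (fun n : ℕ => ∫ ω, Complex.exp
        (((∑ j ∈ Finset.range n, inner ℝ (W j ω) (c j) : ℝ) : ℂ) * Complex.I) ∂μ) Filter.atTop
      (nhds (∫ ω, Complex.exp (((θ 0 * X ω + θ 1 * Y ω : ℝ) : ℂ) * Complex.I) ∂μ)) := by
    refine tendsto_integral_of_dominated_convergence (fun _ => 1) (fun n => ?_)
      (integrable_const _) (fun n => Filter.Eventually.of_forall fun ω => ?_) ?_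
    · have hm : AEMeasurable (fun ω => ∑ j ∈ Finset.range n, inner ℝ (W j ω) (c j)) μ :=
        Finset.aemeasurable_fun_sum _ fun j _ => (hW j).aemeasurable.inner aemeasurable_const
      have he : Continuous fun x : ℝ => Complex.exp ((x : ℂ) * Complex.I) := by fun_prop
      exact (he.measurable.comp_aemeasurable hm).aestronglyMeasurable
    · rw [Complex.norm_exp_ofReal_mul_I]
    · filter_upwards [hX, hY] with ω h1 h2
      have h := ((h1.mul_left (θ 0)).add (h2.mul_left (θ 1))).tendsto_sum_nat
      simp_rw [hcl]
      have he : Continuous fun x : ℝ => Complex.exp ((x : ℂ) * Complex.I) := by fun_prop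
      exact (he.tendsto _).comp h
  have hsum := (hasSum_integral_seriesSpectralMeasure (r := r) (l := l) (Γ := Γ) hα ha hb
    (H := fun v => |inner ℝ θ v| ^ α) (by fun_prop)
    (fun k hk v => rpow_abs_inner_smul θ hk v) (K := ‖θ‖ ^ α) fun v => by
      rw [abs_of_nonneg (by positivity), ← Real.mul_rpow (norm_nonneg _) (norm_nonneg _)]
      exact Real.rpow_le_rpow (abs_nonneg _) (abs_real_inner_le_norm _ _)
        (by linarith)).tendsto_sum_nat
  have hterm : ∀ j, ∫ s, |inner ℝ θ (coordPair r l (a j) (b j) s)| ^ α ∂Γ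
      = ∫ s, |inner ℝ (c j) (s : EuclideanSpace ℝ (Fin d))| ^ α ∂Γ := by
    intro j
    refine integral_congr_ae (Filter.Eventually.of_forall fun s => ?_)
    simp only
    rw [real_inner_comm _ (c j), hcl]
    simp only [coordPair, PiLp.inner_apply, Fin.sum_univ_two]
    congr 2
    simp
    ring
  simp_rw [hterm] at hsum
  simp_rw [integral_cexp_sum_inner hW hind] at hlim
  have he : Continuous fun x : ℝ => Complex.exp (-(x : ℂ)) := by fun_prop
  -- The characteristic functions of the partial sums converge both by dominated convergence and
  -- through their explicit exponents; the limits agree.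
  rw [← tendsto_nhds_unique hlim ((he.tendsto _).comp hsum), charFun_apply,
    integral_map hpm (by fun_prop)]
  refine integral_congr_ae (Filter.Eventually.of_forall fun ω => ?_)
  simp only [pairVec, PiLp.inner_apply, Fin.sum_univ_two]
  simp

/-- The covariation of two series in the coordinates of independent symmetric `α`-stable vectors. -/
theorem covariation_series (hα : 1 < α) {W : ℕ → Ω → EuclideanSpace ℝ (Fin d)}
    (hW : ∀ j, IsSpectralMeasure α μ (W j) Γ) (hind : iIndepFun W μ)
    (ha : Summable fun j => |a j|) (hb : Summable fun j => |b j|) {X Y : Ω → ℝ}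
    (hX : ∀ᵐ ω ∂μ, HasSum (fun j => a j * W j ω r) (X ω))
    (hY : ∀ᵐ ω ∂μ, HasSum (fun j => b j * W j ω l) (Y ω)) :
    covariation α μ X Y = (∑' j, signedPow (b j) (α - 1) * a j)
        * ∫ x, signedPow ((x : EuclideanSpace ℝ (Fin d)) l) (α - 1)
            * (x : EuclideanSpace ℝ (Fin d)) r ∂Γ := by
  rw [(isSpectralMeasure_series hα hW hind ha hb hX hY).covariation_eq hα,
    integral_mul_signedPow_seriesSpectralMeasure hα ha hb]

end Series

/-! ### Aligning series by zero padding -/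

lemma EuclideanSpace.norm_le_sum_abs {d : ℕ} (v : EuclideanSpace ℝ (Fin d)) :
    ‖v‖ ≤ ∑ i, |v i| := by
  calc ‖v‖ = ‖∑ i, v i • EuclideanSpace.single i (1 : ℝ)‖ := by
        congr 1
        ext k
        simp [Pi.single_apply]
    _ ≤ ∑ i, ‖v i • EuclideanSpace.single i (1 : ℝ)‖ := norm_sum_le _ _
    _ = _ := Finset.sum_congr rfl fun i _ => by simp [norm_smul]

lemma hasSum_of_shift {f : ℕ → ℝ} {n : ℕ} {x : ℝ} (h0 : ∀ j < n, f j = 0)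
    (h : HasSum (fun j => f (j + n)) x) : HasSum f x := by
  have := (hasSum_nat_add_iff n).mp h
  rwa [Finset.sum_eq_zero fun j hj => h0 j (Finset.mem_range.mp hj), add_zero] at this

/-- The sequence `c` preceded by `n` zeros. -/
def zeroPad (n : ℕ) (c : ℕ → ℝ) (j : ℕ) : ℝ := if j < n then 0 else c (j - n)

lemma zeroPad_of_lt {n j : ℕ} (c : ℕ → ℝ) (h : j < n) : zeroPad n c j = 0 := if_pos h

lemma zeroPad_add (n : ℕ) (c : ℕ → ℝ) (j : ℕ) : zeroPad n c (j + n) = c j := by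
  simp [zeroPad]

lemma summable_abs_zeroPad (n : ℕ) {c : ℕ → ℝ} (hc : Summable fun j => |c j|) :
    Summable fun j => |zeroPad n c j| := by
  have h : HasSum (fun j => |zeroPad n c j|) (∑' j, |c j|) := by
    refine hasSum_of_shift (n := n) (fun j hj => by simp [zeroPad_of_lt c hj]) ?_
    simpa only [zeroPad_add] using hc.hasSum
  exact h.summable

/-- Since `s - (j + n) = t - j`, a delay by `n` rereads a series based at `t` over the noise indexed
backwards from `s`. -/
lemma hasSum_zeroPad_mul {Ω : Type*} {m : ℕ} {Z : ℤ → Ω → EuclideanSpace ℝ (Fin m)} {c : ℕ → ℝ}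
    {s t : ℤ} {n : ℕ} (hst : s = t + n) {ω : Ω} {r : Fin m} {x : ℝ}
    (h : HasSum (fun j : ℕ => c j * Z (t - j) ω r) x) :
    HasSum (fun j : ℕ => zeroPad n c j * Z (s - j) ω r) x := by
  refine hasSum_of_shift (n := n) (fun j hj => by simp [zeroPad_of_lt c hj]) ?_
  have e : ∀ j : ℕ, s - ((j + n : ℕ) : ℤ) = t - j := fun j => by push_cast; omega
  simpa only [zeroPad_add, e] using h

/-! ### The periodic autoregression -/

section PeriodicAutoregression

variable {Ω : Type*} [MeasurableSpace Ω] {μ : Measure Ω}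
  {m T : ℕ} {α : ℝ} {Γ : Measure (Metric.sphere (0 : EuclideanSpace ℝ (Fin m)) 1)}
  {Z : ℤ → Ω → EuclideanSpace ℝ (Fin m)} {Θ : ℤ → Matrix (Fin m) (Fin m) ℝ}

lemma backProd_add_period (hper : ∀ t, Θ (t + T) = Θ t) (r : Fin m) (t : ℤ) (j : ℕ) :
    backProd (fun u => Θ u r r) t (j + T)
      = periodProd Θ T r * backProd (fun u => Θ u r r) t j := by
  have hd : ∀ u, (fun u => Θ u r r) (u + T) = (fun u => Θ u r r) u := fun u => by
    simp only [hper u]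
  rw [backProd_add, backProd_period hd (t - j), mul_comm]
  rfl

lemma exists_backProd_bound (hT : 0 < T) (hper : ∀ t, Θ (t + T) = Θ t)
    (hP : ∀ r, |periodProd Θ T r| < 1) (r : Fin m) (t : ℤ) :
    ∃ ρ C : ℝ, 0 < ρ ∧ ρ < 1 ∧ 0 ≤ C ∧ ∀ j, |backProd (fun u => Θ u r r) t j| ≤ C * ρ ^ j :=
  exists_geometric_bound hT (hP r) (backProd_add_period hper r t)

lemma summable_abs_backProd (hT : 0 < T) (hper : ∀ t, Θ (t + T) = Θ t)
    (hP : ∀ r, |periodProd Θ T r| < 1) (r : Fin m) (t : ℤ) :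
    Summable fun j => |backProd (fun u => Θ u r r) t j| := by
  obtain ⟨ρ, C, hρ0, hρ1, -, hb⟩ := exists_backProd_bound hT hper hP r t
  exact Summable.of_nonneg_of_le (fun _ => abs_nonneg _) hb
    ((summable_geometric_of_lt_one hρ0.le hρ1).mul_left C)

lemma ae_hasSum_coord (hdiag : ∀ t, ∀ r l : Fin m, r ≠ l → Θ t r l = 0)
    (hsum : ∀ t, ∀ᵐ ω ∂μ, Summable fun j : ℕ => ‖seriesTerm Θ Z t ω j‖)
    {X : ℤ → Ω → EuclideanSpace ℝ (Fin m)}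
    (hX : ∀ t, ∀ᵐ ω ∂μ, X t ω = ∑' j : ℕ, seriesTerm Θ Z t ω j) (r : Fin m) (t : ℤ) :
    ∀ᵐ ω ∂μ, HasSum (fun j : ℕ => backProd (fun u => Θ u r r) t j * Z (t - j) ω r) (X t ω r) := by
  filter_upwards [hsum t, hX t] with ω h1 h2
  have h := h1.of_norm.hasSum.mapL (EuclideanSpace.proj r : EuclideanSpace ℝ (Fin m) →L[ℝ] ℝ)
  rw [← h2] at h
  simpa [seriesTerm_apply hdiag] using h

/-- Past the zeroth term `Z t`, the terms at time `t` are `Θ t` applied to those at `t - 1`, and a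
continuous linear map commutes with the sum. -/
lemma ae_autoregression
    (hsum : ∀ t, ∀ᵐ ω ∂μ, Summable fun j : ℕ => ‖seriesTerm Θ Z t ω j‖)
    {X : ℤ → Ω → EuclideanSpace ℝ (Fin m)}
    (hX : ∀ t, ∀ᵐ ω ∂μ, X t ω = ∑' j : ℕ, seriesTerm Θ Z t ω j) (t : ℤ) :
    ∀ᵐ ω ∂μ, X t ω = Matrix.toEuclideanLin (Θ t) (X (t - 1) ω) + Z t ω := by
  filter_upwards [hsum t, hsum (t - 1), hX t, hX (t - 1)] with ω h1 h2 h3 h4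
  have h := h2.of_norm.hasSum.mapL (LinearMap.toContinuousLinearMap (Matrix.toEuclideanLin (Θ t)))
  rw [h3, h1.of_norm.tsum_eq_zero_add, seriesTerm_zero, add_comm, h4]
  congr 1
  simp_rw [seriesTerm_succ]
  exact h.tsum_eq

variable [IsProbabilityMeasure μ] {X : ℤ → Ω → EuclideanSpace ℝ (Fin m)}

lemma ae_summable_norm_seriesTerm (hT : 0 < T) (hα : 1 < α)
    (hZ : ∀ t, IsSpectralMeasure α μ (Z t) Γ) (hper : ∀ t, Θ (t + T) = Θ t)
    (hdiag : ∀ t, ∀ r l : Fin m, r ≠ l → Θ t r l = 0)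
    (hP : ∀ r, |periodProd Θ T r| < 1) (t : ℤ) :
    ∀ᵐ ω ∂μ, Summable fun j : ℕ => ‖seriesTerm Θ Z t ω j‖ := by
  have h : ∀ᵐ ω ∂μ, ∀ r, Summable fun j : ℕ => |seriesTerm Θ Z t ω j r| := by
    refine ae_all_iff.mpr fun r => ?_
    obtain ⟨ρ, C, hρ0, hρ1, hC, hb⟩ := exists_backProd_bound hT hper hP r t
    simp_rw [seriesTerm_apply hdiag]
    exact ae_summable_abs_mul_coord hα (fun j : ℕ => hZ (t - j)) r hρ0 hρ1 hC hb
  filter_upwards [h] with ω hω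
  exact Summable.of_nonneg_of_le (fun _ => norm_nonneg _)
    (fun j => EuclideanSpace.norm_le_sum_abs _) (summable_sum fun r _ => hω r)

lemma summable_signedPow_mul {α : ℝ} (hα : 1 < α) {a b : ℕ → ℝ} (ha : Summable fun j => |a j|)
    (hb : Summable fun j => |b j|) : Summable fun j => signedPow (b j) (α - 1) * a j := by
  refine Summable.of_norm_bounded_eventually_nat ha ?_
  filter_upwards [hb.tendsto_atTop_zero.eventually_le_const one_pos] with j hj
  rw [Real.norm_eq_abs, abs_mul]
  refine mul_le_of_le_one_left (abs_nonneg _) ((abs_signedPow_le _ _).trans ?_)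
  exact Real.rpow_le_one (abs_nonneg _) hj (by linarith)

/-- Keeps the denominator `1 - P_l^{⟨α-1⟩} P_r` away from zero. -/
lemma abs_signedPow_mul_lt_one {α x y : ℝ} (hα : 1 < α) (hx : |x| < 1) (hy : |y| < 1) :
    |signedPow x (α - 1) * y| < 1 := by
  rw [abs_mul]
  have h : |signedPow x (α - 1)| ≤ 1 :=
    (abs_signedPow_le _ _).trans (Real.rpow_le_one (abs_nonneg _) hx.le (by linarith))
  exact (mul_le_of_le_one_left (abs_nonneg _) h).trans_lt hy

/-- The sum over all lags in terms of one period. -/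
lemma tsum_signedPow_backProd_mul (hT : 0 < T) (hα : 1 < α) (hper : ∀ t, Θ (t + T) = Θ t)
    (hP : ∀ r, |periodProd Θ T r| < 1) (r l : Fin m) (t : ℤ) :
    ∑' j, signedPow (backProd (fun u => Θ u l l) t j) (α - 1) * backProd (fun u => Θ u r r) t j
      = (∑ k ∈ Finset.range T, signedPow (backProd (fun u => Θ u l l) t k) (α - 1)
            * backProd (fun u => Θ u r r) t k)
        / (1 - signedPow (periodProd Θ T l) (α - 1) * periodProd Θ T r) := by
  refine tsum_eq_sum_range_div ?_ (fun j => ?_)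
    (summable_signedPow_mul hα (summable_abs_backProd hT hper hP r t)
      (summable_abs_backProd hT hper hP l t))
  · exact ((le_abs_self _).trans_lt (abs_signedPow_mul_lt_one hα (hP l) (hP r))).ne
  · rw [backProd_add_period hper, backProd_add_period hper, signedPow_mul]
    ring

/-- The signed power of a padded zero is zero, so only lags at least `n` of the other sequence
survive. -/
lemma tsum_signedPow_zeroPad_left {α : ℝ} (n : ℕ) (a b : ℕ → ℝ) :
    ∑' j, signedPow (zeroPad n b j) α * a j = ∑' j, signedPow (b j) α * a (j + n) := by
  have hinj : Function.Injective fun j => j + n := add_left_injective n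
  have h := hinj.tsum_eq (f := fun j => signedPow (zeroPad n b j) α * a j) fun j hj => by
    by_contra hn
    refine hj ?_
    have hlt : j < n := by
      by_contra h
      exact hn ⟨j - n, by simp; omega⟩
    simp [zeroPad_of_lt b hlt, signedPow_zero]
  simpa only [zeroPad_add] using h.symm

lemma tsum_signedPow_zeroPad_right {α : ℝ} (n : ℕ) (a b : ℕ → ℝ) :
    ∑' j, signedPow (b j) α * zeroPad n a j = ∑' j, signedPow (b (j + n)) α * a j := by
  have hinj : Function.Injective fun j => j + n := add_left_injective n
  have h := hinj.tsum_eq (f := fun j => signedPow (b j) α * zeroPad n a j) fun j hj => by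
    by_contra hn
    refine hj ?_
    have hlt : j < n := by
      by_contra h
      exact hn ⟨j - n, by simp; omega⟩
    simp [zeroPad_of_lt a hlt]
  simpa only [zeroPad_add] using h.symm

lemma gMat_apply_self (hdiag : ∀ t, ∀ r l : Fin m, r ≠ l → Θ t r l = 0) {s t : ℤ} {n : ℕ}
    (hst : s = t + n) (r : Fin m) :
    gMat Θ s (t + 1) r r = backProd (fun u => Θ u r r) s n := by
  have h : t + 1 = s - n + 1 := by omega
  rw [h, gMat_natCast, coefProd_eq_diagonal hdiag, Matrix.diagonal_apply_eq]

/-- Both series are read over `Z (s - j)`, so `X_l(t)` is the padded one. In the surviving lags the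
coefficient of `X_r(s)` splits off `g_rr(s, t + 1)`, leaving the sum based at `t`. -/
lemma jointlySaS_and_covariation_of_le (hT : 0 < T) (hα : 1 < α)
    (hZ : ∀ t, IsSpectralMeasure α μ (Z t) Γ) (hindep : iIndepFun Z μ)
    (hper : ∀ t, Θ (t + T) = Θ t) (hdiag : ∀ t, ∀ r l : Fin m, r ≠ l → Θ t r l = 0)
    (hP : ∀ r, |periodProd Θ T r| < 1)
    (hX : ∀ t, ∀ᵐ ω ∂μ, X t ω = ∑' j : ℕ, seriesTerm Θ Z t ω j) (r l : Fin m) {s t : ℤ}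
    (hts : t ≤ s) :
    IsJointlySaS α μ (fun ω => X s ω r) (fun ω => X t ω l) ∧
    covariation α μ (fun ω => X s ω r) (fun ω => X t ω l)
      = gMat Θ s (t + 1) r r
          * (∫ x, signedPow ((x : EuclideanSpace ℝ (Fin m)) l) (α - 1)
              * (x : EuclideanSpace ℝ (Fin m)) r ∂Γ)
          / (1 - signedPow (periodProd Θ T l) (α - 1) * periodProd Θ T r)
          * ∑ k ∈ Finset.range T,
              signedPow (gMat Θ t (t - k + 1) l l) (α - 1) * gMat Θ t (t - k + 1) r r := by
  obtain ⟨n, hn⟩ := Int.le.dest hts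
  have hst : s = t + n := hn.symm
  have := (hZ 0).finite
  have hsum := ae_summable_norm_seriesTerm hT hα hZ hper hdiag hP
  have hWi : iIndepFun (fun j : ℕ => Z (s - j)) μ :=
    hindep.precomp (g := fun j : ℕ => s - j) fun i j h => by simpa using h
  have ha := summable_abs_backProd hT hper hP r s
  have hb := summable_abs_zeroPad n (summable_abs_backProd hT hper hP l t)
  have hXs := ae_hasSum_coord hdiag hsum hX r s
  have hXt := (ae_hasSum_coord hdiag hsum hX l t).mono fun ω h => hasSum_zeroPad_mul hst h
  refine ⟨⟨_, isSpectralMeasure_series hα (fun j : ℕ => hZ (s - j)) hWi ha hb hXs hXt⟩, ?_⟩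
  rw [covariation_series hα (fun j : ℕ => hZ (s - j)) hWi ha hb hXs hXt,
    tsum_signedPow_zeroPad_left, gMat_apply_self hdiag hst]
  have hshift : ∀ j, backProd (fun u => Θ u r r) s (j + n)
      = backProd (fun u => Θ u r r) s n * backProd (fun u => Θ u r r) t j := by
    intro j
    rw [add_comm, backProd_add, hst, add_sub_cancel_right]
  simp_rw [hshift, mul_left_comm _ (backProd _ s n), tsum_mul_left, gMat_natCast,
    coefProd_eq_diagonal hdiag, Matrix.diagonal_apply_eq,
    tsum_signedPow_backProd_mul hT hα hper hP]
  ring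

/-- Mirror case: the noise is read from `t`, and the split-off factor `g_ll(t, s + 1)` leaves the
signed power by multiplicativity. -/
lemma jointlySaS_and_covariation_of_ge (hT : 0 < T) (hα : 1 < α)
    (hZ : ∀ t, IsSpectralMeasure α μ (Z t) Γ) (hindep : iIndepFun Z μ)
    (hper : ∀ t, Θ (t + T) = Θ t) (hdiag : ∀ t, ∀ r l : Fin m, r ≠ l → Θ t r l = 0)
    (hP : ∀ r, |periodProd Θ T r| < 1)
    (hX : ∀ t, ∀ᵐ ω ∂μ, X t ω = ∑' j : ℕ, seriesTerm Θ Z t ω j) (r l : Fin m) {s t : ℤ}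
    (hst : s ≤ t) :
    IsJointlySaS α μ (fun ω => X s ω r) (fun ω => X t ω l) ∧
    covariation α μ (fun ω => X s ω r) (fun ω => X t ω l)
      = signedPow (gMat Θ t (s + 1) l l) (α - 1)
          * (∫ x, signedPow ((x : EuclideanSpace ℝ (Fin m)) l) (α - 1)
              * (x : EuclideanSpace ℝ (Fin m)) r ∂Γ)
          / (1 - signedPow (periodProd Θ T l) (α - 1) * periodProd Θ T r)
          * ∑ k ∈ Finset.range T,
              signedPow (gMat Θ s (s - k + 1) l l) (α - 1) * gMat Θ s (s - k + 1) r r := by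
  obtain ⟨n, hn⟩ := Int.le.dest hst
  have hts : t = s + n := hn.symm
  have := (hZ 0).finite
  have hsum := ae_summable_norm_seriesTerm hT hα hZ hper hdiag hP
  have hWi : iIndepFun (fun j : ℕ => Z (t - j)) μ :=
    hindep.precomp (g := fun j : ℕ => t - j) fun i j h => by simpa using h
  have ha := summable_abs_zeroPad n (summable_abs_backProd hT hper hP r s)
  have hb := summable_abs_backProd hT hper hP l t
  have hXs := (ae_hasSum_coord hdiag hsum hX r s).mono fun ω h => hasSum_zeroPad_mul hts h
  have hXt := ae_hasSum_coord hdiag hsum hX l t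
  refine ⟨⟨_, isSpectralMeasure_series hα (fun j : ℕ => hZ (t - j)) hWi ha hb hXs hXt⟩, ?_⟩
  rw [covariation_series hα (fun j : ℕ => hZ (t - j)) hWi ha hb hXs hXt,
    tsum_signedPow_zeroPad_right, gMat_apply_self hdiag hts]
  have hshift : ∀ j, backProd (fun u => Θ u l l) t (j + n)
      = backProd (fun u => Θ u l l) t n * backProd (fun u => Θ u l l) s j := by
    intro j
    rw [add_comm, backProd_add, hts, add_sub_cancel_right]
  simp_rw [hshift, signedPow_mul, mul_assoc (signedPow (backProd _ t n) _), tsum_mul_left,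
    gMat_natCast, coefProd_eq_diagonal hdiag, Matrix.diagonal_apply_eq,
    tsum_signedPow_backProd_mul hT hα hper hP]
  ring

end PeriodicAutoregression

/-! ### The main theorem -/

theorem lemma2 {Ω : Type*} [MeasurableSpace Ω] (μ : Measure Ω) [IsProbabilityMeasure μ]
    (m T : ℕ) (hT : 0 < T) (α : ℝ) (hα1 : 1 < α) (hα2 : α ≤ 2)
    (Γ : Measure (Metric.sphere (0 : EuclideanSpace ℝ (Fin m)) 1))
    (Z : ℤ → Ω → EuclideanSpace ℝ (Fin m))
    (hZ : ∀ t, IsSpectralMeasure α μ (Z t) Γ)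
    (hindep : iIndepFun Z μ)
    (Θ : ℤ → Matrix (Fin m) (Fin m) ℝ)
    (hper : ∀ t, Θ (t + T) = Θ t)
    (hdiag : ∀ t, ∀ r l : Fin m, r ≠ l → Θ t r l = 0)
    (hP : ∀ r, |periodProd Θ T r| < 1)
    (X : ℤ → Ω → EuclideanSpace ℝ (Fin m))
    (hX : ∀ t, ∀ᵐ ω ∂μ, X t ω = ∑' j : ℕ, seriesTerm Θ Z t ω j) :
    -- the defining series converges absolutely almost surely, and its sum solves the PAR(1) system
    (∀ t, ∀ᵐ ω ∂μ, Summable fun j : ℕ => ‖seriesTerm Θ Z t ω j‖) ∧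
    (∀ t, ∀ᵐ ω ∂μ, X t ω = Matrix.toEuclideanLin (Θ t) (X (t - 1) ω) + Z t ω) ∧
    ∀ r l : Fin m, r ≠ l → ∀ s t : ℤ,
      -- the covariation of the two components is well defined
      IsJointlySaS α μ (fun ω => X s ω r) (fun ω => X t ω l) ∧
      -- the case `s ≥ t`
      (t ≤ s →
        covariation α μ (fun ω => X s ω r) (fun ω => X t ω l)
          = gMat Θ s (t + 1) r r
              * (∫ x, signedPow ((x : EuclideanSpace ℝ (Fin m)) l) (α - 1)
                  * (x : EuclideanSpace ℝ (Fin m)) r ∂Γ)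
              / (1 - signedPow (periodProd Θ T l) (α - 1) * periodProd Θ T r)
              * ∑ k ∈ Finset.range T,
                  signedPow (gMat Θ t (t - k + 1) l l) (α - 1) * gMat Θ t (t - k + 1) r r) ∧
      -- the case `s ≤ t`
      (s ≤ t →
        covariation α μ (fun ω => X s ω r) (fun ω => X t ω l)
          = signedPow (gMat Θ t (s + 1) l l) (α - 1)
              * (∫ x, signedPow ((x : EuclideanSpace ℝ (Fin m)) l) (α - 1)
                  * (x : EuclideanSpace ℝ (Fin m)) r ∂Γ)
              / (1 - signedPow (periodProd Θ T l) (α - 1) * periodProd Θ T r)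
              * ∑ k ∈ Finset.range T,
                  signedPow (gMat Θ s (s - k + 1) l l) (α - 1) * gMat Θ s (s - k + 1) r r) ∧
      -- periodicity in `s` for a fixed difference `s - t`
      covariation α μ (fun ω => X (s + T) ω r) (fun ω => X (t + T) ω l)
        = covariation α μ (fun ω => X s ω r) (fun ω => X t ω l) := by
  have hsum := ae_summable_norm_seriesTerm hT hα1 hZ hper hdiag hP
  refine ⟨hsum, ae_autoregression hsum hX, fun r l _ s t => ?_⟩
  have hle := fun {s t : ℤ} => jointlySaS_and_covariation_of_le (s := s) (t := t)
    hT hα1 hZ hindep hper hdiag hP hX r l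
  have hge := fun {s t : ℤ} => jointlySaS_and_covariation_of_ge (s := s) (t := t)
    hT hα1 hZ hindep hper hdiag hP hX r l
  have hg : ∀ u k : ℤ, gMat Θ (u + T) (u + T - k + 1) = gMat Θ u (u - k + 1) := by
    intro u k
    rw [← gMat_shift hper u]
    congr 1
    ring
  have hg' : ∀ u v : ℤ, gMat Θ (u + T) (v + T + 1) = gMat Θ u (v + 1) := by
    intro u v
    rw [← gMat_shift hper u]
    congr 1
    ring
  refine ⟨?_, fun h => (hle h).2, fun h => (hge h).2, ?_⟩
  · rcases le_total t s with h | h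
    · exact (hle h).1
    · exact (hge h).1
  -- Every factor of the closed formulas is unchanged when both times move by `T`.
  · rcases le_total t s with h | h
    · rw [(hle h).2, (hle (add_le_add_left h (T : ℤ))).2]
      simp_rw [hg, hg']
    · rw [(hge h).2, (hge (add_le_add_left h (T : ℤ))).2]
      simp_rw [hg, hg']
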